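/- Let $q$ be a power of a prime $p$ and let $\mathbb{F}_q$ be the finite field with $q$ elements. For integers $n\ge 1$ and $k\ge 0$, an element $\alpha\in\mathbb{F}_{q^n}$ is called $k$-normal over $\mathbb{F}_q$ if the $\mathbb{F}_q$-vector space spanned by $\alpha,\alpha^q,\ldots,\alpha^{q^{n-1}}$ has dimension $n-k$. Let $\lambda_{q,n,k}$ be the number of $k$-normal elements of $\mathbb{F}_{q^n}$ over $\mathbb{F}_q$ and let $\lambda_{q,k}(n)=\lambda_{q,n,k}/q^n$ be their density. Then for every $k\ge 0$ the mean value $$\overline{\lambda}_{q,k}=\lim_{x\to+\infty}\frac1x\sum_{1\le n\le x}\lambda_{q,k}(n)$$ exists, and $$\overline{\lambda}_{q,k}\ \ge\ \frac{\overline{\lambda}_{q,0}}{p^t q^k}\ >\ 0,$$ where $t=\lfloor\log_p k\rfloor+1$ if $k>0$ and $t=0$ if $k=0$. Moreover, if $q\ge 4$, then $$\overline{\lambda}_{q,0}>1-\frac{1}{\sqrt q}-\frac1q.$$ -/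

import Mathlib

open Filter Topology

/-- `α ∈ L` is `k`-normal over the finite field `K` (`q = |K|`, `n = [L : K]`): the `K`-span of
`α, α ^ q, …, α ^ (q ^ (n - 1))` has dimension `n - k` (so no element is `k`-normal if `n < k`). -/
def IsKNormal (K : Type*) {L : Type*} [Field K] [Field L] [Algebra K L] (k : ℕ) (α : L) : Prop :=
  Module.finrank K (Submodule.span K
    (Set.range fun i : Fin (Module.finrank K L) => α ^ (Nat.card K) ^ (i : ℕ))) + k
      = Module.finrank K L

/-- The number of elements of the degree `n` extension of the finite field `K` (of
characteristic `p`) that are `k`-normal over `K`. -/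
noncomputable def kNormalCount (K : Type*) [Field K] [Finite K] (p : ℕ) [Fact p.Prime] [CharP K p]
    (k n : ℕ) [NeZero n] : ℕ :=
  Nat.card {α : FiniteField.Extension K p n // IsKNormal K k α}

/-- The density of the `k`-normal elements in the degree `n` extension of `K`, `n ≥ 1`
(with the unused value `0` at `n = 0`). -/
noncomputable def kNormalDensity (K : Type*) [Field K] [Finite K] (p : ℕ) [Fact p.Prime]
    [CharP K p] (k n : ℕ) : ℝ :=
  if h : n = 0 then 0
  else
    haveI : NeZero n := ⟨h⟩
    (kNormalCount K p k n : ℝ) / (Nat.card K : ℝ) ^ n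

/-- `m` is the mean value of `f`: the averages `(1 / x) * ∑_{1 ≤ n ≤ x} f n` tend to `m`
as the real number `x` tends to infinity. -/
def HasMeanValue (f : ℕ → ℝ) (m : ℝ) : Prop :=
  Tendsto (fun x : ℝ => 1 / x * ∑ n ∈ Finset.Icc 1 ⌊x⌋₊, f n) atTop (𝓝 m)

/-!
Write `q = |K|` and let `X` act on the extension `L` of degree `n` as the Frobenius map. A normal
element makes `L` isomorphic to `K[X] / (X ^ n - 1)`, and then `a ∈ K[X]` corresponds to a
`k`-normal element exactly if `gcd(a, X ^ n - 1)` has degree `k`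
(`FiniteField.card_isKNormal_eq`). Sieving over irreducible polynomials, which are exactly
independent among the polynomials of bounded degree, gives
`λ_k(n) = q ^ (-k) * ∑_h ∏_P (1 - q ^ (-deg P))`, where `h` runs over the monic divisors of
`X ^ n - 1` of degree `k` and `P` over the monic irreducibles with `P * h ∣ X ^ n - 1`
(`kNormalDensity_eq_sum_gcdDensity`).

For a fixed polynomial `f`, the condition `f ∣ X ^ n - 1` says that `n` is a multiple of the order
of `f`. So if the product is truncated at `deg P ≤ D`, it is a periodic function of `n` and has a
mean value. The error of the truncation is, in mean, at most `∑ q ^ (-deg P) / ord P` over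
`deg P > D`. The irreducibles of degree `i` are the Frobenius orbits of length `i` in the field with
`q ^ i` elements, so that those contribute at most
`q ^ (-i) * (1 / i) * ∑_{d ∣ q ^ i - 1} φ(d) / d ≤ q ^ (-i / 2) / i`, by
`Polynomial.sum_inv_order_le` and the elementary bound `totientRatioSum.le_sqrt`. The series
converges, and the mean values exist. The same truncation bounds the mean for `k = 0` from below by a
positive quantity: take `D` large in general, and `D = 0` if `q ≥ 4`, where the series sums to
`-log (1 - 1 / √q) < 1 / √q + 1 / q`.

For general `k`, the divisor `h = (X - 1) ^ k` of `X ^ (p ^ t * n) - 1 = (X ^ n - 1) ^ (p ^ t)`,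
available since `k < p ^ t`, gives `λ_k(p ^ t * n) ≥ q ^ (-k) * λ_0(n)`; averaging over the multiples
of `p ^ t` yields the comparison of the mean values (`mean_kNormalDensity_ge`).
-/

/-! ### Sieving polynomials of bounded degree over a finite field -/

open Polynomial in
/-- The finite set of polynomials of degree less than `n` over a finite field. -/
noncomputable def polysDegreeLT (K : Type*) [Field K] [Finite K] (n : ℕ) : Finset K[X] :=
  (Set.finite_coe_iff.mp (Module.finite_of_finite K (M := degreeLT K n)) :
    (degreeLT K n : Set K[X]).Finite).toFinset

open Polynomial in
open scoped Classical in
/-- The finite set of monic polynomials of degree `k` over a finite field. -/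
noncomputable def monicPolys (K : Type*) [Field K] [Finite K] (k : ℕ) : Finset K[X] :=
  (polysDegreeLT K (k + 1)).filter fun f => f.Monic ∧ f.natDegree = k

open Polynomial in
open scoped Classical in
/-- The finite set of monic irreducible polynomials of degree at most `D` over a finite field. -/
noncomputable def irredPolys (K : Type*) [Field K] [Finite K] (D : ℕ) : Finset K[X] :=
  (polysDegreeLT K (D + 1)).filter fun f => f.Monic ∧ Irreducible f

namespace Polynomial

variable {K : Type*} [Field K] [Finite K]

lemma mem_polysDegreeLT {n : ℕ} {f : K[X]} : f ∈ polysDegreeLT K n ↔ f.degree < n := by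
  simp [polysDegreeLT, mem_degreeLT]

lemma card_polysDegreeLT (n : ℕ) : (polysDegreeLT K n).card = Nat.card K ^ n := by
  have h := Nat.card_congr (degreeLTEquiv K n).toEquiv
  rw [Nat.card_fun, Nat.card_fin] at h
  rw [← h, ← Set.ncard_coe_finset, polysDegreeLT, Set.Finite.coe_toFinset]
  rfl

lemma mem_monicPolys {k : ℕ} {f : K[X]} : f ∈ monicPolys K k ↔ f.Monic ∧ f.natDegree = k := by
  simp only [monicPolys, Finset.mem_filter, mem_polysDegreeLT, and_iff_right_iff_imp]
  rintro ⟨hf, rfl⟩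
  exact (degree_le_natDegree).trans_lt (by exact_mod_cast Nat.lt_succ_self _)

lemma mem_irredPolys {D : ℕ} {f : K[X]} :
    f ∈ irredPolys K D ↔ (f.Monic ∧ Irreducible f) ∧ f.natDegree ≤ D := by
  simp only [irredPolys, Finset.mem_filter, mem_polysDegreeLT]
  rw [and_comm]
  refine and_congr_right fun hf => ?_
  rw [degree_eq_natDegree hf.1.ne_zero]
  norm_cast
  exact Nat.lt_succ_iff

lemma irredPolys_mono {D E : ℕ} (h : D ≤ E) : irredPolys K D ⊆ irredPolys K E := fun f hf => by
  rw [mem_irredPolys] at hf ⊢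
  exact ⟨hf.1, hf.2.trans h⟩

lemma pairwise_isCoprime_irredPolys (D : ℕ) :
    (irredPolys K D : Set K[X]).Pairwise IsCoprime := by
  intro P hP Q hQ hne
  rw [Finset.mem_coe, mem_irredPolys] at hP hQ
  refine (hP.1.2.coprime_iff_not_dvd).2 fun h => hne ?_
  exact eq_of_monic_of_associated hP.1.1 hQ.1.1 (hP.1.2.associated_of_dvd hQ.1.2 h)

open scoped Classical in
/-- Divisibility by pairwise coprime polynomials is exactly independent on the polynomials of
degree less than `n`, as soon as `n` is at least the sum of their degrees. -/
lemma card_filter_not_dvd (S : Finset K[X]) (h0 : ∀ P ∈ S, P ≠ 0)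
    (hco : (S : Set K[X]).Pairwise IsCoprime) (n : ℕ) (hn : ∑ P ∈ S, P.natDegree ≤ n) :
    (((polysDegreeLT K n).filter fun b => ∀ P ∈ S, ¬ P ∣ b).card : ℝ) =
      (Nat.card K : ℝ) ^ n * ∏ P ∈ S, (1 - ((Nat.card K : ℝ)⁻¹) ^ P.natDegree) := by
  induction S using Finset.induction_on generalizing n with
  | empty => simp [card_polysDegreeLT]
  | insert P S hP ih =>
    have hP0 : P ≠ 0 := h0 P (Finset.mem_insert_self _ _)
    have h0' : ∀ Q ∈ S, Q ≠ 0 := fun Q hQ => h0 Q (Finset.mem_insert_of_mem hQ)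
    have hco' : (S : Set K[X]).Pairwise IsCoprime :=
      hco.mono (by simp [Finset.coe_insert])
    have hPS : ∀ Q ∈ S, IsCoprime Q P := fun Q hQ =>
      hco (by simp [hQ]) (by simp) (fun h => hP (h ▸ hQ))
    rw [Finset.sum_insert hP] at hn
    have h1 := ih h0' hco' n (by omega)
    have h2 := ih h0' hco' (n - P.natDegree) (by omega)
    have hq : (Nat.card K : ℝ) ≠ 0 := by exact_mod_cast Nat.card_pos.ne'
    -- the survivors for `S` that are multiples of `P` are `P` times the survivors of lower degree
    have h3 : ((polysDegreeLT K n).filter fun b => ∀ Q ∈ S, ¬ Q ∣ b).filter (fun b => P ∣ b) =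
        ((polysDegreeLT K (n - P.natDegree)).filter fun b => ∀ Q ∈ S, ¬ Q ∣ b).image (P * ·) := by
      ext b
      simp only [Finset.mem_filter, Finset.mem_image, mem_polysDegreeLT]
      have key (c : K[X]) : (P * c).degree < n ↔ c.degree < (n - P.natDegree : ℕ) := by
        rcases eq_or_ne c 0 with rfl | hc
        · simp
        rw [degree_mul, degree_eq_natDegree hP0, degree_eq_natDegree hc]
        norm_cast
        omega
      constructor
      · rintro ⟨⟨hb, hS⟩, c, rfl⟩
        exact ⟨c, ⟨(key c).1 hb, fun Q hQ h => hS Q hQ (h.mul_left _)⟩, rfl⟩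
      · rintro ⟨c, ⟨hc, hS⟩, rfl⟩
        exact ⟨⟨(key c).2 hc, fun Q hQ h => hS Q hQ ((hPS Q hQ).dvd_of_dvd_mul_left h)⟩,
          dvd_mul_right _ _⟩
    have h4 : ((polysDegreeLT K n).filter fun b => ∀ Q ∈ insert P S, ¬ Q ∣ b) =
        ((polysDegreeLT K n).filter fun b => ∀ Q ∈ S, ¬ Q ∣ b).filter (fun b => ¬ P ∣ b) := by
      ext b
      simp only [Finset.mem_filter, Finset.forall_mem_insert]
      tauto
    have h5 := Finset.card_filter_add_card_filter_not
      (s := (polysDegreeLT K n).filter fun b => ∀ Q ∈ S, ¬ Q ∣ b) (fun b => P ∣ b)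
    rw [h3, Finset.card_image_of_injective _ (mul_right_injective₀ hP0)] at h5
    have h6 : (Nat.card K : ℝ) ^ n =
        (Nat.card K : ℝ) ^ (n - P.natDegree) * (Nat.card K : ℝ) ^ P.natDegree := by
      rw [← pow_add]; congr 1; omega
    rw [h4, Finset.prod_insert hP]
    have h7 : (((polysDegreeLT K (n - P.natDegree)).filter fun b => ∀ Q ∈ S, ¬ Q ∣ b).card : ℝ) +
      ((((polysDegreeLT K n).filter fun b => ∀ Q ∈ S, ¬ Q ∣ b).filter (fun b => ¬ P ∣ b)).card : ℝ)
        = (((polysDegreeLT K n).filter fun b => ∀ Q ∈ S, ¬ Q ∣ b).card : ℝ) := by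
      exact_mod_cast h5
    rw [h1, h2] at h7
    rw [eq_sub_of_add_eq' h7, h6]
    generalize ∏ x ∈ S, (1 - ((Nat.card K : ℝ)⁻¹) ^ x.natDegree) = A
    rw [inv_pow]
    field_simp

open scoped Classical in
/-- The density of the polynomials coprime to `g` is the product of `1 - q ^ (-deg P)` over the
monic irreducible `P ∣ g`. -/
lemma card_filter_isCoprime (g : K[X]) (hg : g ≠ 0) (D : ℕ) (hD : g.natDegree ≤ D) :
    (((polysDegreeLT K g.natDegree).filter fun b => IsCoprime b g).card : ℝ) =
      (Nat.card K : ℝ) ^ g.natDegree *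
        ∏ P ∈ irredPolys K D, (1 - if P ∣ g then ((Nat.card K : ℝ)⁻¹) ^ P.natDegree else 0) := by
  set S := (irredPolys K D).filter (· ∣ g) with hS
  have hco : (S : Set K[X]).Pairwise IsCoprime :=
    (pairwise_isCoprime_irredPolys D).mono (by simp [hS, Set.subset_def]; tauto)
  have h0 : ∀ P ∈ S, P ≠ 0 := fun P hP => by
    rw [hS, Finset.mem_filter, mem_irredPolys] at hP
    exact hP.1.1.2.ne_zero
  have hprod : ∏ P ∈ S, P ∣ g :=
    Finset.prod_dvd_of_coprime hco fun P hP => (Finset.mem_filter.1 hP).2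
  have hdeg : ∑ P ∈ S, P.natDegree ≤ g.natDegree := by
    rw [← natDegree_prod _ _ h0]
    exact natDegree_le_of_dvd hprod hg
  have h := card_filter_not_dvd S h0 hco _ hdeg
  have h1 : ∏ P ∈ irredPolys K D, (1 - if P ∣ g then ((Nat.card K : ℝ)⁻¹) ^ P.natDegree else 0) =
      ∏ P ∈ S, (1 - ((Nat.card K : ℝ)⁻¹) ^ P.natDegree) := by
    rw [hS, Finset.prod_filter]
    refine Finset.prod_congr rfl fun P _ => ?_
    split_ifs <;> simp
  rw [h1, ← h]
  congr 2
  refine Finset.filter_congr fun b _ => ?_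
  constructor
  · intro hb P hP hPb
    rw [hS, Finset.mem_filter, mem_irredPolys] at hP
    exact hP.1.1.2.not_isUnit (hb.isUnit_of_dvd' hPb hP.2)
  · intro hb
    by_contra hn
    obtain ⟨P, hP, hPb, hPg⟩ : ∃ P : K[X], Irreducible P ∧ P ∣ b ∧ P ∣ g := by
      rw [← EuclideanDomain.gcd_isUnit_iff] at hn
      have hgcd : EuclideanDomain.gcd b g ≠ 0 := fun h =>
        hg (EuclideanDomain.gcd_eq_zero_iff.1 h).2
      obtain ⟨P, hP, hd⟩ := WfDvdMonoid.exists_irreducible_factor hn hgcd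
      exact ⟨P, hP, hd.trans (EuclideanDomain.gcd_dvd_left _ _),
        hd.trans (EuclideanDomain.gcd_dvd_right _ _)⟩
    have hnd : normalize P ∣ g := (normalize_associated P).dvd.trans hPg
    refine hb (normalize P) ?_ ((normalize_associated P).dvd.trans hPb)
    rw [hS, Finset.mem_filter, mem_irredPolys]
    refine ⟨⟨⟨monic_normalize hP.ne_zero, (normalize_associated P).symm.irreducible hP⟩, ?_⟩, hnd⟩
    exact (natDegree_le_of_dvd hnd hg).trans hD

end Polynomial

/-! ### The extension as a cyclic module over the polynomial ring -/

namespace FiniteField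
open Polynomial Module

variable {K L : Type*} [Field K] [Fintype K] [Field L] [Finite L] [Algebra K L]

/-- The `K`-span of the first `[L : K]` conjugates of `α` is the `K[X]`-submodule generated by `α`,
where `X` acts on `L` as the Frobenius map. -/
lemma span_conjugates_map_eq_range_toSpanSingleton (α : L) :
    (Submodule.span K (Set.range fun i : Fin (finrank K L) => α ^ (Nat.card K) ^ (i : ℕ))).map
      (AEval'.of (frobeniusAlgHom K L).toLinearMap).toLinearMap =
    ((LinearMap.toSpanSingleton K[X] (AEval' (frobeniusAlgHom K L).toLinearMap)
      (AEval'.of _ α)).restrictScalars K).range := by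
  have := Finite.of_injective _ (algebraMap K L).injective
  set φ := (frobeniusAlgHom K L).toLinearMap with hφ
  have hfin : 0 < finrank K L := finrank_pos
  have hX (i : ℕ) : (X ^ i : K[X]) • AEval'.of φ α = AEval'.of φ (α ^ (Nat.card K) ^ i) := by
    rw [AEval'.X_pow_smul_of, End.smul_def, End.coe_pow, hφ]
    congr 1
    change (⇑(frobeniusAlgHom K L))^[i] α = _
    rw [coe_frobeniusAlgHom, pow_iterate, Fintype.card_eq_nat_card]
  rw [Submodule.map_span]
  apply le_antisymm
  · rw [Submodule.span_le]
    rintro _ ⟨_, ⟨i, rfl⟩, rfl⟩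
    exact ⟨X ^ (i : ℕ), hX i⟩
  · rintro _ ⟨c, rfl⟩
    -- modulo `X ^ [L : K] - 1`, which acts as zero, `c` has degree less than `[L : K]`
    have hmin : aeval φ (X ^ finrank K L - 1 : K[X]) = 0 := by
      rw [hφ, ← minpoly_frobeniusAlgHom]
      exact minpoly.aeval _ _
    have hmonic : (X ^ finrank K L - 1 : K[X]).Monic := monic_X_pow_sub_C 1 hfin.ne'
    have hc : c • AEval'.of φ α = (c %ₘ (X ^ finrank K L - 1)) • AEval'.of φ α := by
      conv_lhs => rw [← modByMonic_add_div c (X ^ finrank K L - 1)]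
      rw [add_smul, mul_comm (X ^ finrank K L - 1) _, mul_smul]
      have : (X ^ finrank K L - 1 : K[X]) • AEval'.of φ α = 0 := by
        rw [← AEval.of_aeval_smul, hmin, zero_smul, map_zero]
      rw [this, smul_zero, add_zero]
    simp only [LinearMap.coe_restrictScalars, LinearMap.toSpanSingleton_apply]
    rw [hc]
    have hdeg : (c %ₘ (X ^ finrank K L - 1)).natDegree < finrank K L := by
      have hnd : (X ^ finrank K L - 1 : K[X]).natDegree = finrank K L :=
        natDegree_X_pow_sub_C (r := (1 : K))
      refine (natDegree_modByMonic_lt c hmonic fun h1 => hfin.ne' ?_).trans_eq hnd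
      rw [← hnd, h1, natDegree_one]
    rw [as_sum_range' (c %ₘ (X ^ finrank K L - 1)) (finrank K L) hdeg, Finset.sum_smul]
    refine Submodule.sum_mem _ fun i hi => ?_
    rw [← C_mul_X_pow_eq_monomial, ← smul_eq_C_mul, smul_assoc, hX]
    exact Submodule.smul_mem _ _ (Submodule.subset_span
      ⟨_, ⟨⟨i, Finset.mem_range.1 hi⟩, rfl⟩, rfl⟩)

/-- The conjugates of `α` span a space whose dimension is the degree of the annihilator of `α`
in `K[X]`, where `X` acts as the Frobenius map. -/
lemma finrank_span_conjugates (α : L) (g : K[X])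
    (hg : (LinearMap.toSpanSingleton K[X] (AEval' (frobeniusAlgHom K L).toLinearMap)
      (AEval'.of _ α)).ker = Ideal.span {g}) :
    finrank K (Submodule.span K
      (Set.range fun i : Fin (finrank K L) => α ^ (Nat.card K) ^ (i : ℕ))) = g.natDegree := by
  rw [← LinearEquiv.finrank_map_eq (AEval'.of (frobeniusAlgHom K L).toLinearMap),
    ← finrank_quotient_span_eq_natDegree (f := g)]
  erw [span_conjugates_map_eq_range_toSpanSingleton]
  rw [← hg]
  exact ((LinearMap.quotKerEquivRange (LinearMap.toSpanSingleton K[X]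
    (AEval' (frobeniusAlgHom K L).toLinearMap) (AEval'.of _ α))).restrictScalars K).finrank_eq.symm

/-- A normal element makes `L` a cyclic `K[X]`-module with annihilator `X ^ [L : K] - 1`. -/
lemma exists_ker_toSpanSingleton_eq_span :
    ∃ β : L, (LinearMap.toSpanSingleton K[X] (AEval' (frobeniusAlgHom K L).toLinearMap)
      (AEval'.of _ β)).ker = Ideal.span {X ^ finrank K L - 1} := by
  obtain ⟨x, hx⟩ := Module.exists_ker_toSpanSingleton_eq_annihilator K[X]
    (AEval' (frobeniusAlgHom K L).toLinearMap)
  obtain ⟨x, rfl⟩ := (AEval'.of _).surjective x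
  refine ⟨x, ?_⟩
  rw [hx, ← minpoly_frobeniusAlgHom, span_minpoly_eq_annihilator]

open scoped Classical in
/-- Choosing a normal element identifies `L` with the polynomials of degree less than
`n = [L : K]` in such a way that `a` is `k`-normal exactly if the gcd of `a` and `X ^ n - 1` has
degree `k`. -/
lemma card_isKNormal_eq (k : ℕ) :
    Nat.card {α : L // IsKNormal K k α} =
      ((polysDegreeLT K (finrank K L)).filter fun a =>
        (EuclideanDomain.gcd a (X ^ finrank K L - 1)).natDegree = k).card := by
  obtain ⟨β, hβ⟩ := exists_ker_toSpanSingleton_eq_span (K := K) (L := L)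
  set φ := (frobeniusAlgHom K L).toLinearMap with hφ
  set n := finrank K L with hn
  have hfin : 0 < n := finrank_pos
  have hmonic : (X ^ n - 1 : K[X]).Monic := monic_X_pow_sub_C 1 hfin.ne'
  have hnd : (X ^ n - 1 : K[X]).natDegree = n := natDegree_X_pow_sub_C (r := (1 : K))
  have hker (c : K[X]) : c • AEval'.of φ β = 0 ↔ X ^ n - 1 ∣ c := by
    rw [← Ideal.mem_span_singleton, ← hβ, LinearMap.mem_ker, LinearMap.toSpanSingleton_apply]
  let F : K[X] → L := fun a => (AEval'.of φ).symm (a • AEval'.of φ β)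
  have hF (a : K[X]) : AEval'.of φ (F a) = a • AEval'.of φ β :=
    LinearEquiv.apply_symm_apply _ _
  have hinj : Set.InjOn F (polysDegreeLT K n) := by
    intro a ha b hb hab
    rw [Finset.mem_coe, mem_polysDegreeLT] at ha hb
    have h1 : (a - b) • AEval'.of φ β = 0 := by
      rw [sub_smul, ← hF, ← hF, hab, sub_self]
    rw [hker] at h1
    by_contra hne
    have h2 := degree_le_of_dvd h1 (sub_ne_zero.2 hne)
    have h3 : (X ^ n - 1 : K[X]).degree = n := degree_X_pow_sub_C hfin (1 : K)
    rw [h3] at h2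
    exact absurd ((degree_sub_le a b).trans_lt (max_lt ha hb)) (not_lt.2 h2)
  have hsurj (α : L) : ∃ a ∈ polysDegreeLT K n, F a = α := by
    have := Fintype.ofFinite L
    have himg : (polysDegreeLT K n).image F = Finset.univ := by
      rw [← Finset.card_eq_iff_eq_univ, Finset.card_image_of_injOn hinj, card_polysDegreeLT,
        Fintype.card_eq_nat_card, hn, ← Module.natCard_eq_pow_finrank]
    simpa using (Finset.ext_iff.1 himg α)
  have hiff (a : K[X]) : IsKNormal K k (F a) ↔
      (EuclideanDomain.gcd a (X ^ n - 1)).natDegree = k := by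
    obtain ⟨b, hb⟩ := EuclideanDomain.gcd_dvd_left a (X ^ n - 1)
    obtain ⟨g, hg⟩ := EuclideanDomain.gcd_dvd_right a (X ^ n - 1)
    set h := EuclideanDomain.gcd a (X ^ n - 1) with hh
    have h0 : h ≠ 0 := fun h0 => hmonic.ne_zero (EuclideanDomain.gcd_eq_zero_iff.1 h0).2
    have hg0 : g ≠ 0 := by rintro rfl; exact hmonic.ne_zero (by rw [hg, mul_zero])
    have hco : IsCoprime g b := by
      have := EuclideanDomain.gcd_eq_gcd_ab a (X ^ n - 1)
      rw [← hh] at this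
      refine ⟨EuclideanDomain.gcdB a (X ^ n - 1), EuclideanDomain.gcdA a (X ^ n - 1), ?_⟩
      generalize EuclideanDomain.gcdA a (X ^ n - 1) = u at *
      generalize EuclideanDomain.gcdB a (X ^ n - 1) = v at *
      apply mul_left_cancel₀ h0
      linear_combination -this - u * hb - v * hg
    have hk : (LinearMap.toSpanSingleton K[X] (AEval' φ) (AEval'.of φ (F a))).ker =
        Ideal.span {g} := by
      ext c
      rw [LinearMap.mem_ker, LinearMap.toSpanSingleton_apply, hF, smul_smul, hker,
        Ideal.mem_span_singleton]
      constructor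
      · intro hd
        rw [hg, hb, mul_left_comm] at hd
        exact hco.dvd_of_dvd_mul_right ((mul_dvd_mul_iff_left h0).1 hd)
      · intro hd
        rw [hg, hb, mul_left_comm]
        exact mul_dvd_mul_left _ (hd.mul_right _)
    have hdeg := congrArg natDegree hg
    rw [hnd, natDegree_mul h0 hg0] at hdeg
    rw [IsKNormal, finrank_span_conjugates _ g hk, ← hn]
    omega
  rw [← Nat.card_eq_finsetCard]
  refine (Nat.card_congr (Equiv.ofBijective (fun a => ⟨F a.1, (hiff _).2 (Finset.mem_filter.1 a.2).2⟩)
    ⟨?_, ?_⟩)).symm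
  · intro a b hab
    exact Subtype.ext (hinj (Finset.mem_filter.1 a.2).1 (Finset.mem_filter.1 b.2).1
      (congrArg Subtype.val hab))
  · rintro ⟨α, hα⟩
    obtain ⟨a, ha, rfl⟩ := hsurj α
    exact ⟨⟨a, Finset.mem_filter.2 ⟨ha, (hiff a).1 hα⟩⟩, rfl⟩

end FiniteField

/-! ### The density of `k`-normal elements as a sum of Euler products -/

open Polynomial in
open scoped Classical in
/-- For a monic `h`, the proportion, among the multiples of `h` modulo `m`, of those whose gcd
with `m` is exactly `h`, as an Euler product over the monic irreducible polynomials of degree at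
most `D`; it is `0` if `h ∤ m`. For `D < deg m` the product is truncated, which makes it an upper
bound for the proportion. -/
noncomputable def gcdDensity {K : Type*} [Field K] [Finite K] (h : K[X]) (D : ℕ) (m : K[X]) : ℝ :=
  if h ∣ m then
    ∏ P ∈ irredPolys K D, (1 - if P * h ∣ m then ((Nat.card K : ℝ)⁻¹) ^ P.natDegree else 0)
  else 0

namespace Polynomial

variable {K : Type*} [Field K] [Finite K]

open scoped Classical in
lemma card_filter_natDegree_gcd (m : K[X]) (hm : m ≠ 0) (k D : ℕ) (hD : m.natDegree ≤ D) :
    (((polysDegreeLT K m.natDegree).filter fun a =>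
        (EuclideanDomain.gcd a m).natDegree = k).card : ℝ) =
      (Nat.card K : ℝ) ^ m.natDegree *
        (((Nat.card K : ℝ)⁻¹) ^ k * ∑ h ∈ monicPolys K k, gcdDensity h D m) := by
  have hq : (Nat.card K : ℝ) ≠ 0 := by exact_mod_cast Nat.card_pos.ne'
  have hgcd0 (a : K[X]) : EuclideanDomain.gcd a m ≠ 0 := fun h0 =>
    hm (EuclideanDomain.gcd_eq_zero_iff.1 h0).2
  rw [Finset.card_eq_sum_card_fiberwise (f := fun a => normalize (EuclideanDomain.gcd a m))
    (t := monicPolys K k)]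
  swap
  · intro a ha
    rw [Finset.mem_coe, Finset.mem_filter] at ha
    rw [Finset.mem_coe, mem_monicPolys]
    refine ⟨monic_normalize (hgcd0 a), ?_⟩
    rw [← ha.2]
    exact natDegree_eq_of_degree_eq degree_normalize
  push_cast
  rw [Finset.mul_sum, Finset.mul_sum]
  refine Finset.sum_congr rfl fun h hh => ?_
  rw [mem_monicPolys] at hh
  have h0 := hh.1.ne_zero
  by_cases hdvd : h ∣ m
  · obtain ⟨g, rfl⟩ := hdvd
    have hg : g ≠ 0 := right_ne_zero_of_mul hm
    have hdeg := natDegree_mul h0 hg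
    have hset : (((polysDegreeLT K (h * g).natDegree).filter fun a =>
        (EuclideanDomain.gcd a (h * g)).natDegree = k).filter fun a =>
          normalize (EuclideanDomain.gcd a (h * g)) = h) =
        ((polysDegreeLT K g.natDegree).filter fun b => IsCoprime b g).image (h * ·) := by
      ext a
      simp only [Finset.mem_filter, Finset.mem_image, mem_polysDegreeLT]
      have key (c : K[X]) : (h * c).degree < ((h * g).natDegree : ℕ) ↔
          c.degree < (g.natDegree : ℕ) := by
        rcases eq_or_ne c 0 with rfl | hc
        · simp
        rw [degree_mul, degree_eq_natDegree h0, degree_eq_natDegree hc, hdeg]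
        norm_cast
        omega
      constructor
      · rintro ⟨⟨ha, -⟩, hn⟩
        have hass : Associated h (EuclideanDomain.gcd a (h * g)) := by
          conv_lhs => rw [← hn]
          exact normalize_associated _
        obtain ⟨b, rfl⟩ := hass.dvd.trans (EuclideanDomain.gcd_dvd_left a (h * g))
        refine ⟨b, ⟨(key b).1 ha, ?_⟩, rfl⟩
        obtain ⟨c, hc⟩ := hass.symm.dvd
        have hbez := EuclideanDomain.gcd_eq_gcd_ab (h * b) (h * g)
        refine ⟨EuclideanDomain.gcdA (h * b) (h * g) * c,
          EuclideanDomain.gcdB (h * b) (h * g) * c, mul_left_cancel₀ h0 ?_⟩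
        linear_combination -hc - c * hbez
      · rintro ⟨b, ⟨hb, x, y, hxy⟩, rfl⟩
        have hass : normalize (EuclideanDomain.gcd (h * b) (h * g)) = h := by
          rw [← hh.1.normalize_eq_self]
          refine normalize_eq_normalize ?_ ?_
          · rw [hh.1.normalize_eq_self]
            have hbez : (h * b) * x + (h * g) * y = h := by linear_combination h * hxy
            have hd := dvd_add ((EuclideanDomain.gcd_dvd_left (h * b) (h * g)).mul_right x)
              ((EuclideanDomain.gcd_dvd_right (h * b) (h * g)).mul_right y)
            rwa [hbez] at hd
          · rw [hh.1.normalize_eq_self]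
            exact EuclideanDomain.dvd_gcd (dvd_mul_right _ _) (dvd_mul_right _ _)
        refine ⟨⟨(key b).2 hb, ?_⟩, hass⟩
        rw [← hh.2]
        conv_rhs => rw [← hass]
        exact (natDegree_eq_of_degree_eq degree_normalize).symm
    rw [hset, Finset.card_image_of_injective _ (mul_right_injective₀ h0),
      card_filter_isCoprime g hg D (by omega), gcdDensity, if_pos (dvd_mul_right h g), ← mul_assoc,
      hdeg, hh.2, pow_add, inv_pow]
    congr 1
    · field_simp
    · refine Finset.prod_congr rfl fun P _ => ?_
      rw [mul_comm P h, mul_dvd_mul_iff_left h0]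
  · rw [gcdDensity, if_neg hdvd, mul_zero, mul_zero, Nat.cast_eq_zero, Finset.card_eq_zero,
      Finset.filter_eq_empty_iff]
    intro a _ hn
    refine hdvd ?_
    rw [← hn]
    exact (normalize_associated _).dvd.trans (EuclideanDomain.gcd_dvd_right a m)

end Polynomial

section

open Polynomial

variable {K : Type*} [Field K] [Finite K] (p : ℕ) [Fact p.Prime] [CharP K p]

/-- The density of `k`-normal elements as a sum of Euler products, one for each monic divisor of
`X ^ n - 1` of degree `k`. -/
lemma kNormalDensity_eq_sum_gcdDensity (k : ℕ) {n D : ℕ} (hn : n ≠ 0) (hD : n ≤ D) :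
    kNormalDensity K p k n =
      ((Nat.card K : ℝ)⁻¹) ^ k * ∑ h ∈ monicPolys K k, gcdDensity h D (X ^ n - 1) := by
  classical
  have := Fintype.ofFinite K
  have : NeZero n := ⟨hn⟩
  have hnd : (X ^ n - 1 : K[X]).natDegree = n := natDegree_X_pow_sub_C (r := (1 : K))
  have hq : (Nat.card K : ℝ) ≠ 0 := by exact_mod_cast Nat.card_pos.ne'
  have hcount := FiniteField.card_isKNormal_eq (K := K) (L := FiniteField.Extension K p n) k
  rw [FiniteField.finrank_extension] at hcount
  have h := card_filter_natDegree_gcd (X ^ n - 1 : K[X])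
    (X_pow_sub_C_ne_zero (Nat.pos_of_ne_zero hn) (1 : K)) k D (hnd.trans_le hD)
  rw [hnd] at h
  rw [kNormalDensity, dif_neg hn, kNormalCount, hcount, h, mul_div_cancel_left₀]
  exact pow_ne_zero _ hq

end

/-! ### A bound for sums of totient ratios -/

/-- The proportion `φ(n) / n` of units modulo `n`, as an arithmetic function. -/
noncomputable def totientRatio : ArithmeticFunction ℝ where
  toFun n := (Nat.totient n : ℝ) / n
  map_zero' := by simp

/-- The sum `∑_{d ∣ N} φ(d) / d`, as an arithmetic function. -/
noncomputable def totientRatioSum : ArithmeticFunction ℝ :=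
  totientRatio * (ArithmeticFunction.zeta : ArithmeticFunction ℝ)

namespace totientRatioSum

lemma apply (N : ℕ) : totientRatioSum N = ∑ d ∈ N.divisors, (Nat.totient d : ℝ) / d := by
  rw [totientRatioSum, ArithmeticFunction.coe_mul_zeta_apply]
  rfl

lemma isMultiplicative : totientRatioSum.IsMultiplicative := by
  refine ArithmeticFunction.IsMultiplicative.mul ⟨?_, ?_⟩
    ArithmeticFunction.isMultiplicative_zeta.natCast
  · simp [totientRatio]
  · intro m n hmn
    simp only [totientRatio, ArithmeticFunction.coe_mk, Nat.totient_mul hmn, Nat.cast_mul]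
    exact mul_div_mul_comm _ _ _ _

lemma apply_prime_pow {l : ℕ} (hl : l.Prime) (a : ℕ) :
    totientRatioSum (l ^ a) = 1 + a * (1 - (l : ℝ)⁻¹) := by
  have hl0 : (l : ℝ) ≠ 0 := by exact_mod_cast hl.ne_zero
  rw [apply, Nat.sum_divisors_prime_pow hl, Finset.sum_range_succ', pow_zero, Nat.totient_one,
    Finset.sum_congr rfl (g := fun _ => 1 - (l : ℝ)⁻¹), Finset.sum_const, Finset.card_range]
  · simp [add_comm]
  · intro i _
    rw [Nat.totient_prime_pow_succ hl, Nat.cast_mul, Nat.cast_sub hl.one_le]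
    push_cast
    field_simp
    ring

lemma sq_two_pow_le {a : ℕ} (ha : a ≠ 1) : totientRatioSum (2 ^ a) ^ 2 ≤ 2 ^ a := by
  rw [apply_prime_pow Nat.prime_two]
  rcases Nat.lt_or_ge a 2 with h | h
  · obtain rfl : a = 0 := by omega
    norm_num
  · induction a, h using Nat.le_induction with
    | base => norm_num
    | succ b hb ih =>
      have hb' : (2 : ℝ) ≤ b := by exact_mod_cast hb
      have := ih (by omega)
      rw [pow_succ (2 : ℝ)]
      push_cast at this ⊢
      nlinarith

lemma sq_three_pow_le {b : ℕ} (hb : 2 ≤ b) : 9 * totientRatioSum (3 ^ b) ^ 2 ≤ 8 * 3 ^ b := by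
  rw [apply_prime_pow Nat.prime_three]
  induction b, hb using Nat.le_induction with
  | base => norm_num
  | succ b hb ih =>
    have hb' : (2 : ℝ) ≤ b := by exact_mod_cast hb
    rw [pow_succ (3 : ℝ)]
    push_cast at ih ⊢
    nlinarith

lemma sq_prime_pow_le {l : ℕ} (hl : l.Prime) (h5 : 5 ≤ l) {a : ℕ} (ha : 0 < a) :
    9 * totientRatioSum (l ^ a) ^ 2 ≤ 8 * (l : ℝ) ^ a := by
  rw [apply_prime_pow hl]
  have h5' : (5 : ℝ) ≤ l := by exact_mod_cast h5
  have hinv : 0 ≤ (l : ℝ)⁻¹ := by positivity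
  have hinv' : (l : ℝ)⁻¹ ≤ 1 := inv_le_one_of_one_le₀ (by linarith)
  have h1 : (1 + a * (1 - (l : ℝ)⁻¹)) ^ 2 ≤ (1 + a : ℝ) ^ 2 := by
    have ha' : (0 : ℝ) ≤ a := by positivity
    refine pow_le_pow_left₀ (by nlinarith) (by nlinarith) 2
  have h2 : 9 * (1 + a : ℝ) ^ 2 ≤ 8 * 5 ^ a := by
    clear h1
    induction a, ha using Nat.le_induction with
    | base => norm_num
    | succ b hb ih =>
      have hb' : (1 : ℝ) ≤ b := by exact_mod_cast hb
      rw [pow_succ (5 : ℝ)]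
      push_cast at ih ⊢
      nlinarith
  have h3 : (5 : ℝ) ^ a ≤ (l : ℝ) ^ a := pow_le_pow_left₀ (by norm_num) h5' a
  linarith

lemma sq_le_of_coprime_six (M : ℕ) (hM : 0 < M) :
    ¬ 2 ∣ M → ¬ 3 ∣ M → M = 1 ∨ 9 * totientRatioSum M ^ 2 ≤ 8 * M := by
  induction M using Nat.recOnPosPrimePosCoprime with
  | prime_pow l a hl ha =>
    intro h2 h3
    right
    have hne2 : l ≠ 2 := by rintro rfl; exact h2 (dvd_pow_self 2 ha.ne')
    have hne3 : l ≠ 3 := by rintro rfl; exact h3 (dvd_pow_self 3 ha.ne')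
    have hne4 : l ≠ 4 := by rintro rfl; exact absurd hl (by norm_num)
    have := hl.two_le
    push_cast
    exact sq_prime_pow_le hl (by omega) ha
  | zero => exact absurd hM (lt_irrefl 0)
  | one => exact fun _ _ => Or.inl rfl
  | coprime a b ha hb hab iha ihb =>
    intro h2 h3
    right
    have h1 := (iha (by omega) (fun h => h2 (h.mul_right b)) fun h => h3 (h.mul_right b)).resolve_left
      (by omega)
    have h1' := (ihb (by omega) (fun h => h2 (h.mul_left a)) fun h => h3 (h.mul_left a)).resolve_left
      (by omega)
    rw [isMultiplicative.map_mul_of_coprime hab]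
    push_cast
    have := mul_le_mul h1 h1' (by positivity) (by positivity)
    have hpos : (0 : ℝ) ≤ (a : ℝ) * b := by positivity
    nlinarith

/-- The `+ 1` is needed for `N = 2` and `N = 6` only. -/
theorem sq_le (N : ℕ) (hN : N ≠ 0) : totientRatioSum N ^ 2 ≤ N + 1 := by
  obtain ⟨a, N', h2, rfl⟩ := Nat.exists_eq_pow_mul_and_not_dvd hN 2 (by norm_num)
  obtain ⟨b, M, h3, rfl⟩ := Nat.exists_eq_pow_mul_and_not_dvd
    (right_ne_zero_of_mul hN) 3 (by norm_num)
  have hM0 : 0 < M := Nat.pos_of_ne_zero (right_ne_zero_of_mul (right_ne_zero_of_mul hN))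
  have h2M : ¬ 2 ∣ M := fun h => h2 (h.mul_left _)
  have hco3 : Nat.Coprime (3 ^ b) M := ((Nat.prime_three.coprime_iff_not_dvd).2 h3).pow_left b
  have hco2 : Nat.Coprime (2 ^ a) (3 ^ b * M) := ((Nat.prime_two.coprime_iff_not_dvd).2 h2).pow_left a
  rw [isMultiplicative.map_mul_of_coprime hco2, isMultiplicative.map_mul_of_coprime hco3]
  have hM := sq_le_of_coprime_six M hM0 h2M h3
  have hF1 : totientRatioSum 1 = 1 := isMultiplicative.map_one
  have hM1 : totientRatioSum M ^ 2 ≤ M := by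
    rcases hM with rfl | hM
    · simp [hF1]
    · have : (0 : ℝ) ≤ M := by positivity
      linarith
  have hb1 : totientRatioSum (3 ^ b) ^ 2 ≤ 3 ^ b := by
    rcases Nat.lt_or_ge b 2 with h | h
    · rw [apply_prime_pow Nat.prime_three]
      interval_cases b <;> norm_num
    · have := sq_three_pow_le h
      have : (0 : ℝ) ≤ 3 ^ b := by positivity
      linarith
  have hMpos : (0 : ℝ) ≤ M := by positivity
  push_cast
  rw [mul_pow, mul_pow]
  by_cases ha : a = 1
  · subst ha
    have hF2 : totientRatioSum (2 ^ 1) ^ 2 = 9 / 4 := by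
      rw [apply_prime_pow Nat.prime_two]; norm_num
    rw [hF2]
    rcases hM with rfl | hM
    · rcases Nat.lt_or_ge b 2 with h | h
      · rw [apply_prime_pow Nat.prime_three, hF1]
        interval_cases b <;> norm_num
      · have := sq_three_pow_le h
        rw [hF1]
        norm_num
        linarith
    · have := mul_le_mul hb1 hM (by positivity) (by positivity)
      linarith
  · have h1 := sq_two_pow_le ha
    have h4 := mul_le_mul h1 (mul_le_mul hb1 hM1 (by positivity) (by positivity))
      (by positivity) (by positivity)
    linarith

/-- A sharp enough form of the divisor bound for the values `N = q ^ i - 1`. -/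
theorem le_sqrt (N : ℕ) (hN : N ≠ 0) : totientRatioSum N ≤ √(N + 1) :=
  Real.le_sqrt_of_sq_le (sq_le N hN)

end totientRatioSum

/-! ### Orders of irreducible polynomials -/

/-- In a finite cyclic group, there are `φ(d)` elements of order `d` for every divisor `d`. -/
lemma IsCyclic.sum_inv_orderOf (G : Type*) [Group G] [Fintype G] [IsCyclic G] :
    ∑ u : G, ((orderOf u : ℝ))⁻¹ = totientRatioSum (Fintype.card G) := by
  classical
  rw [totientRatioSum.apply, ← Finset.sum_fiberwise_of_maps_to (s := Finset.univ)
    (t := (Fintype.card G).divisors) (g := fun u : G => orderOf u)]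
  · refine Finset.sum_congr rfl fun d hd => ?_
    rw [Finset.sum_congr rfl (g := fun _ => ((d : ℝ))⁻¹), Finset.sum_const,
      IsCyclic.card_orderOf_eq_totient (Nat.dvd_of_mem_divisors hd), nsmul_eq_mul, div_eq_mul_inv]
    intro u hu
    rw [(Finset.mem_filter.1 hu).2]
  · intro u _
    exact Nat.mem_divisors.2 ⟨orderOf_dvd_card, Fintype.card_ne_zero⟩

namespace Polynomial

variable {K : Type*} [Field K]

/-- The order of a polynomial: the least `e ≥ 1` with `f ∣ X ^ e - 1`, and `0` if there is no
such `e`. -/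
noncomputable def order (f : K[X]) : ℕ := orderOf (AdjoinRoot.root f)

lemma dvd_X_pow_sub_one_iff (f : K[X]) (n : ℕ) : f ∣ X ^ n - 1 ↔ f.order ∣ n := by
  rw [order, orderOf_dvd_iff_pow_eq_one, ← AdjoinRoot.mk_eq_zero, map_sub, map_pow, map_one,
    AdjoinRoot.mk_X, sub_eq_zero]

variable [Finite K]

open scoped Classical in
/-- The monic irreducible polynomials of degree `i` and order `e` correspond to the orbits of
size `i` formed by elements of order `e` in the unit group of the extension of degree `i`. -/
lemma sum_inv_order_le (D i : ℕ) (hi : i ≠ 0) :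
    ∑ P ∈ (irredPolys K D).filter (fun P => P.natDegree = i), ((P.order : ℝ))⁻¹ ≤
      totientRatioSum (Nat.card K ^ i - 1) / i := by
  have : NeZero i := ⟨hi⟩
  obtain ⟨p, hp⟩ := CharP.exists K
  have : Fact p.Prime := ⟨CharP.char_is_prime K p⟩
  set L := FiniteField.Extension K p i
  have := Fintype.ofFinite L
  have hcard : Fintype.card Lˣ = Nat.card K ^ i - 1 := by
    rw [Fintype.card_units, Fintype.card_eq_nat_card, FiniteField.natCard_extension]
  have hi0 : (0 : ℝ) < i := by exact_mod_cast Nat.pos_of_ne_zero hi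
  rw [le_div_iff₀ hi0, ← hcard, ← IsCyclic.sum_inv_orderOf, Finset.sum_mul]
  refine le_trans (Finset.sum_le_sum fun P hP => ?_) (Finset.sum_fiberwise_le_sum_of_sum_fiber_nonneg
    (s := Finset.univ) (t := (irredPolys K D).filter (fun P => P.natDegree = i))
    (g := fun u : Lˣ => minpoly K (u : L)) (f := fun u : Lˣ => ((orderOf u : ℝ))⁻¹)
    fun _ _ => Finset.sum_nonneg fun _ _ => by positivity)
  rw [Finset.mem_filter, mem_irredPolys] at hP
  obtain ⟨⟨⟨hmon, hirr⟩, -⟩, hdeg⟩ := hP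
  have hord (u : Lˣ) (hu : minpoly K (u : L) = P) : orderOf u = P.order := by
    refine Nat.dvd_right_iff_eq.1 fun n => ?_
    rw [← dvd_X_pow_sub_one_iff, ← hu, minpoly.dvd_iff, orderOf_dvd_iff_pow_eq_one]
    simp [sub_eq_zero, Units.ext_iff]
  rw [Finset.sum_congr rfl (g := fun _ => ((P.order : ℝ))⁻¹)
    fun u hu => by rw [hord u (Finset.mem_filter.1 hu).2], Finset.sum_const, nsmul_eq_mul, mul_comm]
  -- the polynomial `X` has order `0`, and `0⁻¹ = 0` removes it from the sum
  rcases eq_or_ne P.order 0 with h0 | h0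
  · simp [h0]
  refine mul_le_mul_of_nonneg_right ?_ (by positivity)
  have hsplit : (P.map (algebraMap K L)).Splits := by
    refine Splits.of_dvd (IsSplittingField.splits L (X ^ Nat.card K ^ i - X : K[X])) ?_
      (Polynomial.map_dvd (algebraMap K L)
        ((hirr.natDegree_dvd_iff_dvd_X_pow_card_pow_sub_X).1 hdeg.dvd))
    exact map_ne_zero (FiniteField.X_pow_card_pow_sub_X_ne_zero _ hi Finite.one_lt_card)
  have hroots := card_rootSet_eq_natDegree (K := L) (PerfectField.separable_of_irreducible hirr)
    hsplit
  rw [hdeg, Fintype.card_eq_nat_card] at hroots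
  have hsub : P.rootSet L ⊆ ((Finset.univ.filter fun u : Lˣ => minpoly K (u : L) = P).image
      (fun u : Lˣ => (u : L)) : Finset L) := by
    intro x hx
    rw [mem_rootSet] at hx
    have hmin : minpoly K x = P := (minpoly.eq_of_irreducible_of_monic hirr hx.2 hmon).symm
    have hx1 : x ^ P.order = 1 := by
      have := (dvd_X_pow_sub_one_iff P P.order).2 dvd_rfl
      rw [← hmin, minpoly.dvd_iff] at this
      rw [← hmin]
      simpa [sub_eq_zero] using this
    rw [Finset.mem_coe, Finset.mem_image]
    refine ⟨Units.ofPowEqOne x _ hx1 h0, ?_, rfl⟩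
    simpa using hmin
  have h1 := Nat.card_mono (Finset.finite_toSet _) hsub
  rw [hroots, Nat.card_coe_set_eq, Set.ncard_coe_finset] at h1
  exact_mod_cast h1.trans Finset.card_image_le

end Polynomial

/-! ### Mean values -/

/-- The average of `f` over `1, …, N`. -/
noncomputable def average (f : ℕ → ℝ) (N : ℕ) : ℝ := (N : ℝ)⁻¹ * ∑ n ∈ Finset.Icc 1 N, f n

lemma hasMeanValue_iff_tendsto_average {f : ℕ → ℝ} {m : ℝ} :
    HasMeanValue f m ↔ Tendsto (average f) atTop (𝓝 m) := by
  constructor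
  · intro h
    refine (h.comp tendsto_natCast_atTop_atTop).congr fun N => ?_
    simp [average]
  · intro h
    have h1 : Tendsto (fun x : ℝ => (⌊x⌋₊ : ℝ) / x) atTop (𝓝 1) := tendsto_nat_floor_div_atTop
    have h2 := h1.mul (h.comp (tendsto_nat_floor_atTop (α := ℝ)))
    rw [one_mul] at h2
    refine h2.congr' ?_
    filter_upwards [eventually_ge_atTop 1] with x hx
    have h3 : (⌊x⌋₊ : ℝ) ≠ 0 := by exact_mod_cast (Nat.floor_pos.2 hx).ne'
    simp only [Function.comp_apply, average]
    field_simp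

lemma average_mono {f g : ℕ → ℝ} (N : ℕ) (h : ∀ n, n ≠ 0 → n ≤ N → f n ≤ g n) :
    average f N ≤ average g N := by
  refine mul_le_mul_of_nonneg_left (Finset.sum_le_sum fun n hn => ?_) (by positivity)
  have := Finset.mem_Icc.1 hn
  exact h n (by omega) (by omega)

lemma average_sub (f g : ℕ → ℝ) (N : ℕ) :
    average (fun n => f n - g n) N = average f N - average g N := by
  simp only [average, Finset.sum_sub_distrib, mul_sub]

namespace HasMeanValue

variable {f g : ℕ → ℝ} {a b : ℝ}

lemma const_mul (c : ℝ) (hf : HasMeanValue f a) : HasMeanValue (fun n => c * f n) (c * a) := by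
  refine (Tendsto.const_mul c hf).congr fun x => ?_
  rw [← Finset.mul_sum]
  ring

lemma sub (hf : HasMeanValue f a) (hg : HasMeanValue g b) :
    HasMeanValue (fun n => f n - g n) (a - b) := by
  refine (Tendsto.sub hf hg).congr fun x => ?_
  rw [Finset.sum_sub_distrib]
  ring

lemma finset_sum {ι : Type*} {F : ι → ℕ → ℝ} {m : ι → ℝ} (s : Finset ι)
    (h : ∀ i ∈ s, HasMeanValue (F i) (m i)) :
    HasMeanValue (fun n => ∑ i ∈ s, F i n) (∑ i ∈ s, m i) := by
  refine (tendsto_finsetSum s h).congr fun x => ?_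
  rw [← Finset.mul_sum, Finset.sum_comm]

lemma congr (h : ∀ n, n ≠ 0 → f n = g n) (hf : HasMeanValue f a) : HasMeanValue g a := by
  refine Tendsto.congr (fun x => ?_) hf
  rw [Finset.sum_congr rfl fun n hn => h n (by have := Finset.mem_Icc.1 hn; omega)]

end HasMeanValue

lemma sum_Icc_ite_dvd (e N : ℕ) :
    ∑ n ∈ Finset.Icc 1 N, (if e ∣ n then (1 : ℝ) else 0) = ((N / e : ℕ) : ℝ) := by
  rw [Finset.sum_boole, ← Nat.Ioc_filter_dvd_card_eq_div]
  rfl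

/-- The multiples of `e` have density `1 / e`; for `e = 0` both are zero. -/
lemma hasMeanValue_ite_dvd (e : ℕ) :
    HasMeanValue (fun n => if e ∣ n then (1 : ℝ) else 0) (e : ℝ)⁻¹ := by
  rw [hasMeanValue_iff_tendsto_average]
  have h : ∀ N, average (fun n => if e ∣ n then (1 : ℝ) else 0) N = ((N / e : ℕ) : ℝ) / N := by
    intro N
    rw [average, sum_Icc_ite_dvd, mul_comm, div_eq_mul_inv]
  refine Tendsto.congr (fun N => (h N).symm) ?_
  have h1 : Tendsto (fun x : ℝ => (⌊(e : ℝ)⁻¹ * x⌋₊ : ℝ) / x) atTop (𝓝 (e : ℝ)⁻¹) :=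
    tendsto_nat_floor_mul_div_atTop (by positivity)
  refine (h1.comp tendsto_natCast_atTop_atTop).congr fun N => ?_
  simp only [Function.comp_apply]
  rw [mul_comm, ← div_eq_mul_inv, Nat.floor_div_eq_div]

/-- Products of indicators of multiples are indicators of multiples, of the lcm; so expanding the
product reduces the claim to such indicators. -/
lemma exists_hasMeanValue_prod {ι : Type*} (s : Finset ι) (e : ι → ℕ) (w : ι → ℝ) (d : ℕ) :
    ∃ m, HasMeanValue (fun n => if d ∣ n then
      ∏ i ∈ s, (1 - if e i ∣ n then w i else 0) else 0) m := by
  classical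
  induction s using Finset.induction_on generalizing d with
  | empty => exact ⟨_, hasMeanValue_ite_dvd d⟩
  | insert j s hj ih =>
    obtain ⟨m₁, h₁⟩ := ih d
    obtain ⟨m₂, h₂⟩ := ih (d.lcm (e j))
    refine ⟨_, (h₁.sub (h₂.const_mul (w j))).congr fun n _ => ?_⟩
    simp only [Finset.prod_insert hj, Nat.lcm_dvd_iff]
    split_ifs <;> simp_all
    ring

/-- A function that is approximated in mean, up to arbitrarily small errors, by functions having a
mean value has a mean value. -/
lemma exists_hasMeanValue_of_approx (f : ℕ → ℝ) (g : ℕ → ℕ → ℝ) (r : ℕ → ℝ)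
    (hr : Tendsto r atTop (𝓝 0)) (hg : ∀ D, ∃ m, HasMeanValue (g D) m)
    (h : ∀ D N, D ≤ N → |average f N - average (g D) N| ≤ r D) : ∃ m, HasMeanValue f m := by
  suffices hC : CauchySeq (average f) by
    obtain ⟨m, hm⟩ := cauchySeq_tendsto_of_complete hC
    exact ⟨m, hasMeanValue_iff_tendsto_average.2 hm⟩
  rw [Metric.cauchySeq_iff]
  intro ε hε
  obtain ⟨D, hD⟩ := (hr.eventually_lt_const (show (0 : ℝ) < ε / 3 by positivity)).exists
  obtain ⟨m, hm⟩ := hg D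
  obtain ⟨N₀, hN₀⟩ := Metric.cauchySeq_iff.1
    (hasMeanValue_iff_tendsto_average.1 hm).cauchySeq (ε / 3) (by positivity)
  refine ⟨max D N₀, fun M hM N hN => ?_⟩
  have h1 := abs_le.1 (h D M ((le_max_left _ _).trans hM))
  have h2 := abs_le.1 (h D N ((le_max_left _ _).trans hN))
  have h3 := hN₀ M ((le_max_right _ _).trans hM) N ((le_max_right _ _).trans hN)
  rw [Real.dist_eq, abs_lt] at h3 ⊢
  constructor <;> linarith [h3.1, h3.2, h1.1, h1.2, h2.1, h2.2]

/-- Weierstrass' product inequality. -/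
lemma one_sub_sum_le_prod_one_sub {ι : Type*} (s : Finset ι) (w : ι → ℝ)
    (h0 : ∀ i ∈ s, 0 ≤ w i) (h1 : ∀ i ∈ s, w i ≤ 1) :
    1 - ∑ i ∈ s, w i ≤ ∏ i ∈ s, (1 - w i) := by
  classical
  induction s using Finset.induction_on with
  | empty => simp
  | insert j s hj ih =>
    rw [Finset.sum_insert hj, Finset.prod_insert hj]
    have hj0 := h0 j (Finset.mem_insert_self _ _)
    have hj1 := h1 j (Finset.mem_insert_self _ _)
    have h2 := ih (fun i hi => h0 i (Finset.mem_insert_of_mem hi))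
      fun i hi => h1 i (Finset.mem_insert_of_mem hi)
    have h3 : 0 ≤ ∑ i ∈ s, w i := Finset.sum_nonneg fun i hi => h0 i (Finset.mem_insert_of_mem hi)
    nlinarith

/-- A tail of the series of `-log (1 - x)`. -/
lemma sum_Ioc_pow_div_le {x : ℝ} (hx0 : 0 ≤ x) (hx1 : x < 1) (D E : ℕ) :
    ∑ i ∈ Finset.Ioc D E, x ^ i / i ≤ x ^ (D + 1) / ((D + 1) * (1 - x)) := by
  have h1 : (0 : ℝ) < 1 - x := by linarith
  have hD : (0 : ℝ) < D + 1 := by positivity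
  rcases Nat.lt_or_ge E D with h | h
  · rw [Finset.Ioc_eq_empty (by omega), Finset.sum_empty]
    positivity
  have hgeom : (1 - x) * ∑ i ∈ Finset.Ioc D E, x ^ i = x ^ (D + 1) - x ^ (E + 1) := by
    induction E, h using Nat.le_induction with
    | base => simp
    | succ n hn ih =>
      rw [Finset.sum_Ioc_succ_top (by omega), mul_add, ih]
      ring
  have hle : ∑ i ∈ Finset.Ioc D E, x ^ i / i ≤ (∑ i ∈ Finset.Ioc D E, x ^ i) / (D + 1) := by
    rw [Finset.sum_div]
    refine Finset.sum_le_sum fun i hi => ?_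
    have : (D + 1 : ℝ) ≤ i := by exact_mod_cast (Finset.mem_Ioc.1 hi).1
    gcongr
  refine hle.trans ?_
  rw [div_le_div_iff₀ hD (by positivity)]
  have : 0 ≤ x ^ (E + 1) := by positivity
  nlinarith

lemma sum_Ioc_zero_pow_div_le {x : ℝ} (hx0 : 0 ≤ x) (hx1 : x ≤ 1 / 2) (E : ℕ) :
    ∑ i ∈ Finset.Ioc 0 E, x ^ i / i ≤ x + 5 / 6 * x ^ 2 := by
  have h2 : ∑ i ∈ Finset.Ioc 0 E, x ^ i / i ≤ ∑ i ∈ Finset.Ioc 0 (E + 2), x ^ i / i :=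
    Finset.sum_le_sum_of_subset_of_nonneg (Finset.Ioc_subset_Ioc_right (by omega))
      fun _ _ _ => by positivity
  have h3 := sum_Ioc_pow_div_le hx0 (show x < 1 by linarith) 2 (E + 2)
  rw [← Finset.sum_Ioc_consecutive _ (Nat.zero_le 2) (show 2 ≤ E + 2 by omega)] at h2
  have h4 : ∑ i ∈ Finset.Ioc (0 : ℕ) 2, x ^ i / (i : ℝ) = x + x ^ 2 / 2 := by
    rw [Finset.sum_Ioc_succ_top (by omega), Finset.sum_Ioc_succ_top (by omega)]
    simp
  have h5 : x ^ (2 + 1) / (((2 : ℕ) + 1) * (1 - x)) ≤ x ^ 2 / 3 := by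
    rw [div_le_div_iff₀ (by push_cast; linarith) (by norm_num)]
    push_cast
    have : 0 ≤ x ^ 2 := by positivity
    nlinarith
  linarith

/-! ### The mean of the Euler products -/

namespace Polynomial

variable {K : Type*} [Field K] [Finite K]

lemma one_lt_natCard_real : (1 : ℝ) < Nat.card K := by exact_mod_cast Finite.one_lt_card

/-- The tail of the series `∑_P q ^ (-deg P) / ord P` over the monic irreducible `P`, from degree
`D + 1` on. -/
lemma sum_irredPolys_sdiff_le [DecidableEq K[X]] (D E : ℕ) :
    ∑ P ∈ irredPolys K E \ irredPolys K D, ((Nat.card K : ℝ)⁻¹) ^ P.natDegree * (P.order : ℝ)⁻¹ ≤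
      ∑ i ∈ Finset.Ioc D E, (√(Nat.card K))⁻¹ ^ i / i := by
  classical
  have hq := one_lt_natCard_real (K := K)
  rw [← Finset.sum_fiberwise_of_maps_to (t := Finset.Ioc D E) (g := fun P : K[X] => P.natDegree)]
  swap
  · intro P hP
    rw [Finset.mem_sdiff, mem_irredPolys, mem_irredPolys] at hP
    rw [Finset.mem_Ioc]
    refine ⟨?_, hP.1.2⟩
    by_contra h
    exact hP.2 ⟨hP.1.1, by omega⟩
  refine Finset.sum_le_sum fun i hi => ?_
  have hi0 : i ≠ 0 := by have := Finset.mem_Ioc.1 hi; omega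
  have hqi : 1 < Nat.card K ^ i := Nat.one_lt_pow hi0 Finite.one_lt_card
  have h1 : ∑ P ∈ (irredPolys K E \ irredPolys K D).filter (fun P => P.natDegree = i),
      ((Nat.card K : ℝ)⁻¹) ^ P.natDegree * (P.order : ℝ)⁻¹ ≤
      ((Nat.card K : ℝ)⁻¹) ^ i *
        ∑ P ∈ (irredPolys K E).filter (fun P => P.natDegree = i), (P.order : ℝ)⁻¹ := by
    rw [Finset.mul_sum]
    rw [Finset.sum_congr rfl (g := fun P => ((Nat.card K : ℝ)⁻¹) ^ i * (P.order : ℝ)⁻¹)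
      fun P hP => by rw [(Finset.mem_filter.1 hP).2]]
    exact Finset.sum_le_sum_of_subset_of_nonneg
      (Finset.filter_subset_filter _ Finset.sdiff_subset) fun _ _ _ => by positivity
  have h2 := sum_inv_order_le (K := K) E i hi0
  have h3 := totientRatioSum.le_sqrt (Nat.card K ^ i - 1) (by omega)
  have h4 : (((Nat.card K ^ i - 1 : ℕ) : ℝ) + 1) = (Nat.card K : ℝ) ^ i := by
    rw [Nat.cast_sub hqi.le]
    push_cast
    ring
  rw [h4] at h3
  have h5 : ((Nat.card K : ℝ)⁻¹) ^ i * √((Nat.card K : ℝ) ^ i) = (√(Nat.card K))⁻¹ ^ i := by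
    have hs : (√(Nat.card K : ℝ)) ≠ 0 := by positivity
    have hsq : (Nat.card K : ℝ) = √(Nat.card K) ^ 2 := (Real.sq_sqrt (by positivity)).symm
    have h6 : √((Nat.card K : ℝ) ^ i) = √(Nat.card K) ^ i := by
      rw [Real.sqrt_eq_iff_eq_sq (by positivity) (by positivity), ← pow_mul, mul_comm, pow_mul,
        ← hsq]
    rw [h6, inv_pow, inv_pow]
    nth_rw 1 [hsq]
    rw [← pow_mul, mul_comm 2 i, pow_mul]
    field_simp
  refine h1.trans ?_
  rw [← h5, mul_div_assoc]
  exact mul_le_mul_of_nonneg_left (h2.trans (by gcongr)) (by positivity)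

open scoped Classical in
/-- The number of monic irreducible divisors `P` of `X ^ n - 1` of degree in `(D, E]`, each counted
with weight `q ^ (-deg P)`. -/
noncomputable def tailWeight (K : Type*) [Field K] [Finite K] (D E n : ℕ) : ℝ :=
  ∑ P ∈ irredPolys K E \ irredPolys K D,
    if P.order ∣ n then ((Nat.card K : ℝ)⁻¹) ^ P.natDegree else 0

lemma tailWeight_nonneg (D E n : ℕ) : 0 ≤ tailWeight K D E n :=
  Finset.sum_nonneg fun _ _ => by split_ifs <;> positivity

lemma average_tailWeight_le (D E N : ℕ) :
    average (tailWeight K D E) N ≤ ∑ i ∈ Finset.Ioc D E, (√(Nat.card K))⁻¹ ^ i / i := by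
  classical
  refine le_trans ?_ (sum_irredPolys_sdiff_le D E)
  simp only [average, tailWeight]
  rw [Finset.sum_comm, Finset.mul_sum]
  refine Finset.sum_le_sum fun P _ => ?_
  have h : ∑ n ∈ Finset.Icc 1 N, (if P.order ∣ n then ((Nat.card K : ℝ)⁻¹) ^ P.natDegree else 0) =
      ((Nat.card K : ℝ)⁻¹) ^ P.natDegree * ((N / P.order : ℕ) : ℝ) := by
    rw [← sum_Icc_ite_dvd, Finset.mul_sum]
    exact Finset.sum_congr rfl fun n _ => by split_ifs <;> simp
  rw [h, mul_left_comm]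
  refine mul_le_mul_of_nonneg_left ?_ (by positivity)
  rcases Nat.eq_zero_or_pos N with rfl | hN
  · simp
  have hN' : (0 : ℝ) < N := by exact_mod_cast hN
  rw [inv_mul_le_iff₀ hN', ← div_eq_mul_inv]
  exact Nat.cast_div_le

lemma weight_le_one (P : K[X]) : ((Nat.card K : ℝ)⁻¹) ^ P.natDegree ≤ 1 :=
  pow_le_one₀ (by positivity) (inv_le_one_of_one_le₀ one_lt_natCard_real.le)

open scoped Classical in
lemma factor_mem_Icc (m P h : K[X]) :
    (1 - if P * h ∣ m then ((Nat.card K : ℝ)⁻¹) ^ P.natDegree else 0) ∈ Set.Icc (0 : ℝ) 1 := by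
  have h1 := weight_le_one P
  have h2 : 0 ≤ ((Nat.card K : ℝ)⁻¹) ^ P.natDegree := by positivity
  split_ifs <;> constructor <;> linarith

lemma gcdDensity_nonneg (h : K[X]) (D : ℕ) (m : K[X]) : 0 ≤ gcdDensity h D m := by
  rw [gcdDensity]
  split_ifs
  · exact Finset.prod_nonneg fun P _ => (factor_mem_Icc m P h).1
  · rfl

lemma gcdDensity_le_one (h : K[X]) (D : ℕ) (m : K[X]) : gcdDensity h D m ≤ 1 := by
  rw [gcdDensity]
  split_ifs
  · exact Finset.prod_le_one (fun P _ => (factor_mem_Icc m P h).1)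
      fun P _ => (factor_mem_Icc m P h).2
  · exact zero_le_one

lemma gcdDensity_anti (h m : K[X]) {D E : ℕ} (hDE : D ≤ E) :
    gcdDensity h E m ≤ gcdDensity h D m := by
  classical
  rw [gcdDensity, gcdDensity]
  split_ifs
  · rw [← Finset.prod_sdiff (irredPolys_mono hDE)]
    refine mul_le_of_le_one_left (Finset.prod_nonneg fun P _ => (factor_mem_Icc m P h).1) ?_
    exact Finset.prod_le_one (fun P _ => (factor_mem_Icc m P h).1)
      fun P _ => (factor_mem_Icc m P h).2
  · rfl

/-- The truncated products are stationary once they reach the degree of the modulus. -/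
lemma gcdDensity_eq_of_le (h m : K[X]) (hm : m ≠ 0) {D E : ℕ} (hD : m.natDegree ≤ D)
    (hDE : D ≤ E) : gcdDensity h E m = gcdDensity h D m := by
  classical
  rw [gcdDensity, gcdDensity]
  split_ifs
  · refine (Finset.prod_subset (irredPolys_mono hDE) fun P hP hPD => ?_).symm
    rw [if_neg, sub_zero]
    intro hdvd
    rw [mem_irredPolys] at hP hPD
    exact hPD ⟨hP.1, (natDegree_le_of_dvd ((dvd_mul_right _ _).trans hdvd) hm).trans hD⟩
  · rfl

/-- Extending the range of the product from degree `D` to degree `E` costs at most the factor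
`1 - tailWeight`. -/
lemma gcdDensity_mul_one_sub_tailWeight_le (h : K[X]) {D E : ℕ} (hDE : D ≤ E) (n : ℕ) :
    gcdDensity h D (X ^ n - 1) * (1 - tailWeight K D E n) ≤ gcdDensity h E (X ^ n - 1) := by
  classical
  rw [gcdDensity, gcdDensity]
  split_ifs with hd
  swap
  · rw [zero_mul]
  rw [← Finset.prod_sdiff (irredPolys_mono hDE), mul_comm]
  refine mul_le_mul_of_nonneg_right ?_ (Finset.prod_nonneg fun P _ => (factor_mem_Icc _ P h).1)
  refine le_trans ?_ (one_sub_sum_le_prod_one_sub _ _ (fun P _ => ?_) fun P _ => ?_)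
  · rw [tailWeight]
    refine sub_le_sub_left (Finset.sum_le_sum fun P _ => ?_) 1
    by_cases h1 : P * h ∣ X ^ n - 1
    · rw [if_pos h1, if_pos ((dvd_X_pow_sub_one_iff P n).1 ((dvd_mul_right _ _).trans h1))]
    · rw [if_neg h1]
      split_ifs <;> positivity
  · linarith [(factor_mem_Icc (X ^ n - 1) P h).2]
  · linarith [(factor_mem_Icc (X ^ n - 1) P h).1]

/-- The untruncated density for the modulus `X ^ n - 1` (for `n ≠ 0`): all irreducible divisors of
`X ^ n - 1` have degree at most `n`. -/
noncomputable def fullDensity (h : K[X]) (n : ℕ) : ℝ := gcdDensity h n (X ^ n - 1)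

lemma fullDensity_eq_gcdDensity (h : K[X]) {n D : ℕ} (hn : n ≠ 0) (hD : n ≤ D) :
    fullDensity h n = gcdDensity h D (X ^ n - 1) :=
  (gcdDensity_eq_of_le h _ (X_pow_sub_C_ne_zero (Nat.pos_of_ne_zero hn) (1 : K))
    (natDegree_X_pow_sub_C (r := (1 : K))).le hD).symm

lemma exists_hasMeanValue_gcdDensity (h : K[X]) (D : ℕ) :
    ∃ m, HasMeanValue (fun n => gcdDensity h D (X ^ n - 1)) m := by
  classical
  obtain ⟨m, hm⟩ := exists_hasMeanValue_prod (irredPolys K D) (fun P => (P * h).order)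
    (fun P => ((Nat.card K : ℝ)⁻¹) ^ P.natDegree) h.order
  refine ⟨m, hm.congr fun n _ => ?_⟩
  simp only [gcdDensity, dvd_X_pow_sub_one_iff]

lemma inv_sqrt_natCard_mem : 0 < (√(Nat.card K : ℝ))⁻¹ ∧ (√(Nat.card K : ℝ))⁻¹ < 1 := by
  have h := one_lt_natCard_real (K := K)
  have h1 : 1 < √(Nat.card K : ℝ) := Real.lt_sqrt_of_sq_lt (by simpa using h)
  exact ⟨by positivity, inv_lt_one_of_one_lt₀ h1⟩

/-- An upper bound for the mean of the tail weights beyond degree `D`. -/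
noncomputable def tailBound (K : Type*) [Field K] [Finite K] (D : ℕ) : ℝ :=
  (√(Nat.card K : ℝ))⁻¹ ^ (D + 1) / ((D + 1) * (1 - (√(Nat.card K : ℝ))⁻¹))

lemma tendsto_tailBound : Tendsto (tailBound K) atTop (𝓝 0) := by
  obtain ⟨h0, h1⟩ := inv_sqrt_natCard_mem (K := K)
  have hpos : 0 < 1 - (√(Nat.card K : ℝ))⁻¹ := by linarith
  have hlim : Tendsto (fun D : ℕ => (√(Nat.card K : ℝ))⁻¹ ^ (D + 1) *
      (1 - (√(Nat.card K : ℝ))⁻¹)⁻¹) atTop (𝓝 0) := by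
    have := ((tendsto_pow_atTop_nhds_zero_of_lt_one h0.le h1).comp
      (tendsto_add_atTop_nat 1)).mul_const (1 - (√(Nat.card K : ℝ))⁻¹)⁻¹
    simpa using this
  refine squeeze_zero (fun D => by rw [tailBound]; positivity) (fun D => ?_) hlim
  rw [tailBound, div_eq_mul_inv, mul_inv]
  refine mul_le_mul_of_nonneg_left (mul_le_of_le_one_left (by positivity) ?_) (by positivity)
  exact inv_le_one_of_one_le₀ (by linarith [(Nat.cast_nonneg D : (0 : ℝ) ≤ D)])

theorem exists_hasMeanValue_fullDensity (h : K[X]) : ∃ m, HasMeanValue (fullDensity h) m := by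
  obtain ⟨h0, h1⟩ := inv_sqrt_natCard_mem (K := K)
  refine exists_hasMeanValue_of_approx _ (fun D n => gcdDensity h D (X ^ n - 1)) (tailBound K)
    tendsto_tailBound (exists_hasMeanValue_gcdDensity h) fun D N hDN => ?_
  have hle : average (fullDensity h) N ≤ average (fun n => gcdDensity h D (X ^ n - 1)) N := by
    refine average_mono N fun n hn hnN => ?_
    rw [fullDensity_eq_gcdDensity h hn hnN]
    exact gcdDensity_anti h _ hDN
  have htail := (average_tailWeight_le (K := K) D N N).trans
    (sum_Ioc_pow_div_le h0.le h1 D N)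
  have hge : average (fun n => gcdDensity h D (X ^ n - 1) - fullDensity h n) N ≤
      average (tailWeight K D N) N := by
    refine average_mono N fun n hn hnN => ?_
    rw [fullDensity_eq_gcdDensity h hn hnN]
    have h2 := gcdDensity_mul_one_sub_tailWeight_le h hDN n
    have h3 := gcdDensity_le_one h D (X ^ n - 1)
    have h4 := tailWeight_nonneg (K := K) D N n
    nlinarith
  rw [average_sub] at hge
  rw [abs_le, tailBound]
  constructor <;> linarith [htail, hle, hge,
    show 0 ≤ average (tailWeight K D N) N from
      mul_nonneg (by positivity) (Finset.sum_nonneg fun n _ => tailWeight_nonneg D N n)]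

/-- The product of `1 - q ^ (-deg P)` over all monic irreducible `P` of degree at most `D`, a
lower bound for the truncated products with `h = 1` that does not depend on the modulus. -/
noncomputable def minDensity (K : Type*) [Field K] [Finite K] (D : ℕ) : ℝ :=
  ∏ P ∈ irredPolys K D, (1 - ((Nat.card K : ℝ)⁻¹) ^ P.natDegree)

lemma minDensity_pos (D : ℕ) : 0 < minDensity K D := by
  refine Finset.prod_pos fun P hP => ?_
  rw [mem_irredPolys] at hP
  exact sub_pos.2 (pow_lt_one₀ (by positivity) (inv_lt_one_of_one_lt₀ one_lt_natCard_real)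
    hP.1.2.natDegree_pos.ne')

lemma minDensity_zero : minDensity K 0 = 1 := by
  rw [minDensity, show irredPolys K 0 = ∅ from ?_, Finset.prod_empty]
  refine Finset.eq_empty_of_forall_notMem fun P hP => ?_
  rw [mem_irredPolys] at hP
  have := hP.1.2.natDegree_pos
  omega

lemma minDensity_le_gcdDensity_one (D : ℕ) (m : K[X]) : minDensity K D ≤ gcdDensity 1 D m := by
  rw [gcdDensity, if_pos (one_dvd m)]
  refine Finset.prod_le_prod (fun P _ => by linarith [weight_le_one P]) fun P _ => ?_
  have : 0 ≤ ((Nat.card K : ℝ)⁻¹) ^ P.natDegree := by positivity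
  split_ifs <;> linarith

/-- Truncating at degree `D`, the polynomials of larger degree only cost their mean weight. -/
lemma minDensity_mul_le_average {D N : ℕ} (hN : N ≠ 0) (hDN : D ≤ N) :
    minDensity K D * (1 - ∑ i ∈ Finset.Ioc D N, (√(Nat.card K))⁻¹ ^ i / i) ≤
      average (fullDensity (1 : K[X])) N := by
  have hN' : (N : ℝ) ≠ 0 := by exact_mod_cast hN
  have hpos := minDensity_pos (K := K) D
  have h1 : average (fun n => minDensity K D * (1 - tailWeight K D N n)) N ≤
      average (fullDensity (1 : K[X])) N := by
    refine average_mono N fun n hn hnN => ?_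
    rw [fullDensity_eq_gcdDensity 1 hn hnN]
    rcases le_total (tailWeight K D N n) 1 with ht | ht
    · refine le_trans ?_ (gcdDensity_mul_one_sub_tailWeight_le 1 hDN n)
      exact mul_le_mul_of_nonneg_right (minDensity_le_gcdDensity_one D _) (by linarith)
    · exact (mul_nonpos_of_nonneg_of_nonpos hpos.le (by linarith)).trans (gcdDensity_nonneg _ _ _)
  refine le_trans ?_ h1
  have h2 : average (fun n => minDensity K D * (1 - tailWeight K D N n)) N =
      minDensity K D * (1 - average (tailWeight K D N) N) := by
    simp only [average, ← Finset.mul_sum, Finset.sum_sub_distrib, Finset.sum_const,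
      Nat.card_Icc, nsmul_eq_mul, Nat.add_sub_cancel, mul_one]
    field_simp
  rw [h2]
  exact mul_le_mul_of_nonneg_left (by linarith [average_tailWeight_le (K := K) D N N]) hpos.le

theorem mean_fullDensity_one_pos {m : ℝ} (hm : HasMeanValue (fullDensity (1 : K[X])) m) :
    0 < m := by
  obtain ⟨h0, h1⟩ := inv_sqrt_natCard_mem (K := K)
  obtain ⟨D, hD⟩ := ((tendsto_tailBound (K := K)).eventually_lt_const zero_lt_one).exists
  refine lt_of_lt_of_le (mul_pos (minDensity_pos (K := K) D) (sub_pos.2 hD)) ?_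
  refine ge_of_tendsto (hasMeanValue_iff_tendsto_average.1 hm) ?_
  filter_upwards [eventually_ge_atTop (D + 1)] with N hN
  refine le_trans ?_ (minDensity_mul_le_average (D := D) (N := N) (by omega) (by omega))
  refine mul_le_mul_of_nonneg_left (sub_le_sub_left ?_ 1) (minDensity_pos (K := K) D).le
  exact sum_Ioc_pow_div_le h0.le h1 D N

theorem lt_mean_fullDensity_one (h4 : 4 ≤ Nat.card K) {m : ℝ}
    (hm : HasMeanValue (fullDensity (1 : K[X])) m) :
    1 - 1 / √(Nat.card K) - 1 / Nat.card K < m := by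
  obtain ⟨h0, h1⟩ := inv_sqrt_natCard_mem (K := K)
  have h4' : (4 : ℝ) ≤ Nat.card K := by exact_mod_cast h4
  have h2 : 2 ≤ √(Nat.card K : ℝ) := Real.le_sqrt_of_sq_le (by linarith)
  have hx : (√(Nat.card K : ℝ))⁻¹ ≤ 1 / 2 := by
    rw [one_div]
    exact inv_anti₀ (by norm_num) h2
  have hsq : (Nat.card K : ℝ)⁻¹ = (√(Nat.card K : ℝ))⁻¹ ^ 2 := by
    rw [inv_pow, Real.sq_sqrt (by positivity)]
  rw [one_div, one_div, hsq]
  set x := (√(Nat.card K : ℝ))⁻¹ with hxdef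
  have hlt : 1 - x - x ^ 2 < 1 - (x + 5 / 6 * x ^ 2) := by nlinarith
  refine lt_of_lt_of_le hlt (ge_of_tendsto (hasMeanValue_iff_tendsto_average.1 hm) ?_)
  filter_upwards [eventually_ge_atTop 1] with N hN
  have h5 := minDensity_mul_le_average (K := K) (D := 0) (N := N) (by omega) (Nat.zero_le N)
  rw [minDensity_zero, one_mul] at h5
  linarith [sum_Ioc_zero_pow_div_le h0.le hx N]

end Polynomial

/-! ### The mean density of `k`-normal elements -/

section

open Polynomial

variable {K : Type*} [Field K] [Finite K] (p : ℕ) [Fact p.Prime] [CharP K p]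

lemma kNormalDensity_eq_sum_fullDensity (k : ℕ) {n : ℕ} (hn : n ≠ 0) :
    kNormalDensity K p k n =
      ((Nat.card K : ℝ)⁻¹) ^ k * ∑ h ∈ monicPolys K k, fullDensity h n :=
  kNormalDensity_eq_sum_gcdDensity p k hn le_rfl

lemma kNormalDensity_zero_eq {n : ℕ} (hn : n ≠ 0) :
    kNormalDensity K p 0 n = fullDensity (1 : K[X]) n := by
  rw [kNormalDensity_eq_sum_fullDensity p 0 hn, pow_zero, one_mul,
    show monicPolys K 0 = {1} from ?_, Finset.sum_singleton]
  ext f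
  rw [mem_monicPolys, Finset.mem_singleton]
  constructor
  · rintro ⟨h1, h2⟩
    exact h1.natDegree_eq_zero.1 h2
  · rintro rfl
    exact ⟨monic_one, natDegree_one⟩

lemma exists_hasMeanValue_kNormalDensity (k : ℕ) : ∃ m, HasMeanValue (kNormalDensity K p k) m := by
  choose m hm using fun h : K[X] => exists_hasMeanValue_fullDensity h
  exact ⟨_, ((HasMeanValue.finset_sum (monicPolys K k) fun h _ => hm h).const_mul _).congr
    fun n hn => (kNormalDensity_eq_sum_fullDensity p k hn).symm⟩

lemma kNormalDensity_nonneg (k n : ℕ) : 0 ≤ kNormalDensity K p k n := by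
  rw [kNormalDensity]
  split_ifs
  · rfl
  · positivity

/-- If `k < p ^ t`, then `(X - 1) ^ k` divides `X ^ (p ^ t * n) - 1 = (X ^ n - 1) ^ (p ^ t)`, and
this divisor of degree `k` alone accounts for the stated proportion. -/
lemma kNormalDensity_zero_le {k t : ℕ} (hk : k < p ^ t) {n : ℕ} (hn : n ≠ 0) :
    ((Nat.card K : ℝ)⁻¹) ^ k * kNormalDensity K p 0 n ≤ kNormalDensity K p k (p ^ t * n) := by
  classical
  have hpt : 0 < p ^ t := by omega
  have hle : n ≤ p ^ t * n := Nat.le_mul_of_pos_left n hpt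
  have hpn : p ^ t * n ≠ 0 := by positivity
  rw [kNormalDensity_zero_eq p hn, kNormalDensity_eq_sum_fullDensity p k hpn]
  refine mul_le_mul_of_nonneg_left ?_ (by positivity)
  have hmem : (X - 1 : K[X]) ^ k ∈ monicPolys K k := by
    rw [mem_monicPolys]
    refine ⟨(monic_X_sub_C (1 : K)).pow k, ?_⟩
    have := natDegree_X_sub_C (1 : K)
    rw [map_one] at this
    rw [natDegree_pow, this, mul_one]
  refine le_trans ?_ (Finset.single_le_sum (fun h _ => gcdDensity_nonneg h _ _) hmem)
  have hpow : (X ^ (p ^ t * n) - 1 : K[X]) = (X ^ n - 1) ^ p ^ t := by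
    rw [sub_pow_char_pow, one_pow, ← pow_mul, mul_comm]
  have hdvd : (X - 1 : K[X]) ^ k ∣ X ^ (p ^ t * n) - 1 := by
    rw [hpow]
    refine (pow_dvd_pow_of_dvd ?_ k).trans (pow_dvd_pow _ hk.le)
    simpa using sub_dvd_pow_sub_pow (X : K[X]) 1 n
  rw [fullDensity_eq_gcdDensity 1 hn hle, gcdDensity, gcdDensity,
    if_pos (one_dvd _), if_pos hdvd]
  refine Finset.prod_le_prod (fun P _ => (factor_mem_Icc _ P 1).1) fun P hP => ?_
  rw [mem_irredPolys] at hP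
  refine sub_le_sub_left ?_ 1
  by_cases h1 : P * (X - 1) ^ k ∣ X ^ (p ^ t * n) - 1
  · have h2 : P ∣ X ^ n - 1 := by
      rw [hpow] at h1
      exact hP.1.2.prime.dvd_of_dvd_pow ((dvd_mul_right _ _).trans h1)
    rw [if_pos h1, if_pos (by rwa [mul_one])]
  · rw [if_neg h1]
    split_ifs <;> positivity

lemma mean_kNormalDensity_ge {k t : ℕ} (hk : k < p ^ t) {m₀ m : ℝ}
    (h₀ : HasMeanValue (kNormalDensity K p 0) m₀) (h : HasMeanValue (kNormalDensity K p k) m) :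
    m₀ / ((p : ℝ) ^ t * (Nat.card K : ℝ) ^ k) ≤ m := by
  have hpt : 0 < p ^ t := by omega
  -- only the `n` divisible by `p ^ t` are used, and the averages are taken along such `n`
  have hlim : Tendsto (fun M => average (kNormalDensity K p k) (p ^ t * M)) atTop (𝓝 m) :=
    (hasMeanValue_iff_tendsto_average.1 h).comp
      (tendsto_id.const_mul_atTop' hpt)
  have hlim₀ : Tendsto (fun M => average (kNormalDensity K p 0) M /
      ((p : ℝ) ^ t * (Nat.card K : ℝ) ^ k)) atTop
      (𝓝 (m₀ / ((p : ℝ) ^ t * (Nat.card K : ℝ) ^ k))) :=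
    (hasMeanValue_iff_tendsto_average.1 h₀).div_const _
  refine le_of_tendsto_of_tendsto' hlim₀ hlim fun M => ?_
  have hsum : ((Nat.card K : ℝ)⁻¹) ^ k * ∑ n ∈ Finset.Icc 1 M, kNormalDensity K p 0 n ≤
      ∑ n ∈ Finset.Icc 1 (p ^ t * M), kNormalDensity K p k n := by
    rw [Finset.mul_sum]
    have h1 : ∑ n ∈ Finset.Icc 1 M, kNormalDensity K p k (p ^ t * n) ≤
        ∑ n ∈ Finset.Icc 1 (p ^ t * M), kNormalDensity K p k n := by
      rw [← Finset.sum_image (f := kNormalDensity K p k)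
        (fun a _ b _ hab => Nat.eq_of_mul_eq_mul_left hpt hab)]
      refine Finset.sum_le_sum_of_subset_of_nonneg ?_ fun n _ _ => kNormalDensity_nonneg p k n
      intro n hn
      obtain ⟨a, ha, rfl⟩ := Finset.mem_image.1 hn
      rw [Finset.mem_Icc] at ha ⊢
      exact ⟨Nat.mul_pos hpt ha.1, Nat.mul_le_mul_left _ ha.2⟩
    refine le_trans (Finset.sum_le_sum fun n hn => ?_) h1
    exact kNormalDensity_zero_le p hk (by have := Finset.mem_Icc.1 hn; omega)
  calc average (kNormalDensity K p 0) M / ((p : ℝ) ^ t * (Nat.card K : ℝ) ^ k)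
      = ((p ^ t * M : ℕ) : ℝ)⁻¹ *
        (((Nat.card K : ℝ)⁻¹) ^ k * ∑ n ∈ Finset.Icc 1 M, kNormalDensity K p 0 n) := by
        rw [average, Nat.cast_mul, Nat.cast_pow, mul_inv, inv_pow, div_eq_mul_inv, mul_inv]
        ring
    _ ≤ average (kNormalDensity K p k) (p ^ t * M) :=
        mul_le_mul_of_nonneg_left hsum (by positivity)

end

theorem corollary2 (p : ℕ) [Fact p.Prime] (K : Type*) [Field K] [Finite K] [CharP K p]
    (q : ℕ) (hq : Nat.card K = q) :
    ∃ lbar : ℕ → ℝ,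
      (∀ k : ℕ, HasMeanValue (kNormalDensity K p k) (lbar k)) ∧
      (∀ k t : ℕ, t = (if k = 0 then 0 else Nat.log p k + 1) →
        lbar k ≥ lbar 0 / ((p : ℝ) ^ t * (q : ℝ) ^ k) ∧
        lbar 0 / ((p : ℝ) ^ t * (q : ℝ) ^ k) > 0) ∧
      (4 ≤ q → lbar 0 > 1 - 1 / Real.sqrt q - 1 / q) := by
  subst hq
  choose lbar hlbar using fun k => exists_hasMeanValue_kNormalDensity (K := K) p k
  have h₀ : HasMeanValue (Polynomial.fullDensity (1 : Polynomial K)) (lbar 0) :=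
    (hlbar 0).congr fun n hn => kNormalDensity_zero_eq p hn
  have hp : p.Prime := Fact.out
  refine ⟨lbar, hlbar, fun k t ht => ⟨?_, ?_⟩, fun h4 => Polynomial.lt_mean_fullDensity_one h4 h₀⟩
  · refine mean_kNormalDensity_ge p ?_ (hlbar 0) (hlbar k)
    split_ifs at ht with hk
    · simp [hk, ht]
    · rw [ht]
      exact Nat.lt_pow_succ_log_self hp.one_lt k
  · have hq : (0 : ℝ) < Nat.card K := by exact_mod_cast Nat.card_pos
    have hp' : (0 : ℝ) < p := by exact_mod_cast hp.pos
    exact div_pos (Polynomial.mean_fullDensity_one_pos h₀) (by positivity)
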